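/- Consider $W\ge 1$ unit independent tasks that are spread arbitrarily over the local queues of $m\ge 1$ processors and are executed by cooperative work stealing in discrete time. Let $w_i(t)$ be the number of tasks in the queue of processor $i$ at time $t$, so $\sum_i w_i(0)=W$. In the time slot from $t$ to $t+1$, every idle processor (one with $w_i(t)=0$) sends a steal request to a processor chosen uniformly at random among the $m-1$ other processors; given the history up to time $t$, the choices of the different idle processors are independent. Every active processor $i$ (one with $w_i(t)\ge 1$) executes one of its tasks. If it receives $k\ge 0$ requests, then all of them are served at once: the remaining $w_i(t)-1$ tasks are divided into $k+1$ parts whose sizes differ by at most one, one part staying with $i$ and one going to each of the $k$ thieves, and these are the queues at time $t+1$ (which of them get the larger parts is arbitrary, but does not anticipate future choices). A request to an idle processor brings nothing. The makespan is $C^{\mathrm{coop}}_{\max}=\min\{t : w_i(t)=0 \text{ for all } i\}$. Then $C^{\mathrm{coop}}_{\max}$ is almost surely finite and $$\mathbb{E}\bigl[C^{\mathrm{coop}}_{\max}\bigr]\le \frac{W}{m}+2.88\,\log_2 W+3.4,$$ and for every $\varepsilon>0$ $$\mathbb{P}\Bigl(C^{\mathrm{coop}}_{\max}\ge \frac{W}{m}+2.88\,\log_2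 W+2+\log_2\frac1\varepsilon\Bigr)\le\varepsilon .$$ -/

import Mathlib

open MeasureTheory

namespace CoopStealing

/-- The processors whose queue is empty; each of them sends one steal request in the time slot. -/
def idle {m : ℕ} (w : Fin m → ℕ) : Finset (Fin m) :=
  Finset.univ.filter fun j => w j = 0

/-- The processors that send their request to processor `i` when the queue sizes are `w` and
processor `j`, if idle, targets processor `f j`. -/
def thieves {m : ℕ} (w : Fin m → ℕ) (f : Fin m → Fin m) (i : Fin m) : Finset (Fin m) :=
  (idle w).filter fun j => f j = i

/-- `CoopStep w f w'`: queue sizes `w` may turn into `w'` in one time slot of cooperative work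
stealing when every idle processor `j` targets `f j`. Every active processor `i` executes one of its
tasks, and its other `w i - 1` tasks are divided, as evenly as possible, into `k + 1` parts, one for
`i` and one for each of its `k` thieves. Which of the parts are the larger ones is left open. -/
structure CoopStep {m : ℕ} (w : Fin m → ℕ) (f : Fin m → Fin m) (w' : Fin m → ℕ) : Prop where
  /-- A request to an idle processor brings nothing. -/
  failed : ∀ j, w j = 0 → w (f j) = 0 → w' j = 0
  /-- The executed task leaves the system, the other tasks are shared by victim and thieves. -/
  total : ∀ i, 0 < w i → w' i + (∑ j ∈ thieves w f i, w' j) + 1 = w i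
  /-- Any two parts differ by at most one task. -/
  balanced : ∀ i, 0 < w i → ∀ j ∈ insert i (thieves w f i),
    w' j = (w i - 1) / ((thieves w f i).card + 1) ∨
      w' j = (w i - 1) / ((thieves w f i).card + 1) + 1

/-- Cooperative work stealing of `W` unit independent tasks on `m` processors, on a probability
space with filtration `ℱ` (the history): `w t ω i` is the number of tasks in the queue of processor
`i` at time `t`, and `target t ω j` is the processor from which `j`, if idle, tries to steal in the
time slot from `t` to `t + 1`. -/
structure IsCoopWorkStealing {Ω : Type*} [MeasurableSpace Ω] (P : Measure Ω)
    (ℱ : Filtration ℕ (inferInstance : MeasurableSpace Ω)) (m W : ℕ)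
    (w : ℕ → Ω → Fin m → ℕ) (target : ℕ → Ω → Fin m → Fin m) : Prop where
  adapted : ∀ t, Measurable[ℱ t] (w t)
  measurable_target : ∀ t, Measurable (target t)
  /-- The `W` tasks are initially spread arbitrarily. -/
  init : ∀ᵐ ω ∂P, ∑ i, w 0 ω i = W
  /-- Given the history up to time `t`, the idle processors choose their targets independently,
  each one uniformly among the `m - 1` other processors: if the set of idle processors is `S`
  throughout an event `A` of the history, then the choices `f j ≠ j`, `j ∈ S`, have conditional
  probability `(1 / (m - 1)) ^ #S` given `A`. -/
  request : ∀ (t : ℕ) (S : Finset (Fin m)) (f : Fin m → Fin m) (A : Set Ω),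
    (∀ j ∈ S, f j ≠ j) → MeasurableSet[ℱ t] A → (∀ ω ∈ A, idle (w t ω) = S) →
      P.real (A ∩ {ω | ∀ j ∈ S, target t ω j = f j}) =
        P.real A * (1 / ((m : ℝ) - 1)) ^ S.card
  step : ∀ t, ∀ᵐ ω ∂P, CoopStep (w t ω) (target t ω) (w (t + 1) ω)

/-- The makespan: the first time at which all queues are empty. -/
noncomputable def makespan {Ω : Type*} {m : ℕ} (w : ℕ → Ω → Fin m → ℕ) (ω : Ω) : ℕ :=
  sInf {t | ∀ i, w t ω i = 0}

end CoopStealing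

namespace CoopStealing

/-! The potential is Φ = ∑ (w_i³ − w_i). A victim and its k thieves together keep at most 1/(k+1)²
of the victim's contribution (`sum_cube_sub_self_le`). If r processors are idle, k is binomial with
parameters r and 1/(m−1), and the mean of 1/(k+1)² is at most exp(−rate·r/m)
(`sum_requests_inv_sq_le`). The same slot executes m − r tasks, so exp(rate·(tasks left)/m) loses
the complementary factor exp(−rate·(1 − r/m)). Hence, whatever r is, the product `discounted` of Φ
and this exponential shrinks in mean by exp(−rate) per slot (`sum_stepBound_le`), starting from at
most W³·exp(rate·W/m).

A queue with two tasks forces Φ ≥ 6, so Markov's inequality bounds the probability that one exists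
(`IsCoopWorkStealing.measure_exists_two_le`). Once all queues hold at most one task, the next slot
empties them. The rate (25/24)·log 2 is small enough for the binomial estimate; absorbing W³ then
costs 3·log W / rate = 2.88·log₂ W slots, and each further slot at least halves the tail bound. Both
the deviation bound and, after summation, the mean follow. -/

/-- The exponential rate at which steal requests reduce the potential. -/
noncomputable def rate : ℝ := 25 / 24 * Real.log 2

theorem rate_pos : 0 < rate := by
  have := Real.log_pos (one_lt_two)
  unfold rate; positivity

/-! ### Analytic estimate for the mean of 1/(k+1)² -/

/-- This turns the mean of 1/(k+1)² into a double integral of the generating function of k, which is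
explicit for a binomial variable. -/
theorem integral_integral_mul_pow (k : ℕ) :
    ∫ x in (0 : ℝ)..1, ∫ y in (0 : ℝ)..1, (x * y) ^ k = 1 / ((k : ℝ) + 1) ^ 2 := by
  simp only [mul_pow, intervalIntegral.integral_const_mul, intervalIntegral.integral_mul_const,
    integral_pow]
  have : (k : ℝ) + 1 ≠ 0 := by positivity
  simp
  field_simp

theorem integral_integral_finset_sum {ι : Type*} (s : Finset ι) (c : ι → ℝ) (k : ι → ℕ) :
    ∫ x in (0 : ℝ)..1, ∫ y in (0 : ℝ)..1, ∑ i ∈ s, c i * (x * y) ^ k i =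
      ∑ i ∈ s, c i * (1 / ((k i : ℝ) + 1) ^ 2) := by
  have h1 : ∀ x : ℝ, ∫ y in (0 : ℝ)..1, ∑ i ∈ s, c i * (x * y) ^ k i =
      ∑ i ∈ s, ∫ y in (0 : ℝ)..1, c i * (x * y) ^ k i := fun x =>
    intervalIntegral.integral_finsetSum fun i _ =>
      Continuous.intervalIntegrable (by fun_prop) _ _
  simp only [h1]
  rw [intervalIntegral.integral_finsetSum]
  · refine Finset.sum_congr rfl fun i _ => ?_
    simp only [intervalIntegral.integral_const_mul, integral_integral_mul_pow]
  · intro i _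
    apply Continuous.intervalIntegrable
    exact intervalIntegral.continuous_parametric_intervalIntegral_of_continuous' (by fun_prop) _ _

theorem integral_integral_mono {g h : ℝ → ℝ} (hg : Continuous g) (hh : Continuous h)
    (hgh : ∀ s ∈ Set.Icc (0 : ℝ) 1, g s ≤ h s) :
    ∫ x in (0 : ℝ)..1, ∫ y in (0 : ℝ)..1, g (x * y) ≤
      ∫ x in (0 : ℝ)..1, ∫ y in (0 : ℝ)..1, h (x * y) := by
  have hc : ∀ {u : ℝ → ℝ}, Continuous u →
      Continuous fun x : ℝ => ∫ y in (0 : ℝ)..1, u (x * y) := fun hu =>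
    intervalIntegral.continuous_parametric_intervalIntegral_of_continuous' (by fun_prop) _ _
  refine intervalIntegral.integral_mono_on zero_le_one ((hc hg).intervalIntegrable _ _)
    ((hc hh).intervalIntegrable _ _) fun x hx => ?_
  refine intervalIntegral.integral_mono_on zero_le_one
    (Continuous.intervalIntegrable (by fun_prop) _ _)
    (Continuous.intervalIntegrable (by fun_prop) _ _) fun y hy => ?_
  exact hgh _ ⟨mul_nonneg hx.1 hy.1, mul_le_one₀ hx.2 hy.1 hy.2⟩

theorem polynomial_le_exp_rate {b : ℝ} (h0 : 0 ≤ b) (h1 : b ≤ 1) :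
    1 + b / 4 + b ^ 2 / 18 + b ^ 3 / 96 + b ^ 4 / 480 ≤ Real.exp (b - rate * b) := by
  -- This is 1 − rate rounded down; at b = 1 the final comparison has a margin of only about 0.002.
  have ha : (0.27797 : ℝ) ≤ 1 - rate := by
    have := Real.log_two_lt_d9
    unfold rate; linarith
  have h2 : (0.27797 : ℝ) * b ≤ b - rate * b := by nlinarith
  have h3 := Real.sum_le_exp_of_nonneg (x := 0.27797 * b) (by positivity) 4
  have h4 := Real.exp_le_exp.mpr h2
  refine le_trans ?_ (h3.trans h4)
  simp only [Finset.sum_range_succ, Finset.sum_range_zero, Nat.factorial]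
  norm_num
  -- In the difference of the two sides only the linear coefficient is positive, and it outweighs
  -- the others, so replacing each power by b suffices.
  have e2 : b ^ 2 ≤ b := by nlinarith
  have e3 : b ^ 3 ≤ b := by nlinarith [mul_nonneg h0 (sub_nonneg.2 e2)]
  have e4 : b ^ 4 ≤ b := by nlinarith [mul_nonneg h0 (sub_nonneg.2 e3)]
  ring_nf
  linarith

/-- Since 1 − x ≤ exp(−x), the integrand is at most exp(−b)·exp(b·s) with b = r/n and s = xy.
Integrating a Taylor bound termwise divides the k-th term by (k+1)², and `polynomial_le_exp_rate`
applies. -/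
theorem integral_integral_one_sub_pow_le {r n : ℕ} (hr : r ≤ n) (hn : 0 < n) :
    ∫ x in (0 : ℝ)..1, ∫ y in (0 : ℝ)..1, (1 - (1 - x * y) / n) ^ r ≤
      Real.exp (-rate * (r / n)) := by
  have hn' : (0 : ℝ) < n := by exact_mod_cast hn
  have hn1 : (1 : ℝ) ≤ n := by exact_mod_cast hn
  set b : ℝ := r / n with hb
  have hb0 : 0 ≤ b := by positivity
  have hb1 : b ≤ 1 := by
    rw [hb, div_le_one hn']; exact_mod_cast hr
  -- The quartic coefficient 5/96 is the remainder term of `Real.exp_bound'` at order 4.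
  let d : ℕ → ℝ := fun k => Real.exp (-b) *
    if k = 4 then 5 / 96 * b ^ 4 else b ^ k / (k.factorial : ℝ)
  have key : ∀ s ∈ Set.Icc (0 : ℝ) 1,
      (1 - (1 - s) / n) ^ r ≤ ∑ k ∈ Finset.range 5, d k * s ^ k := by
    rintro s ⟨hs0, hs1⟩
    have e1 : 0 ≤ 1 - (1 - s) / n := by
      rw [sub_nonneg, div_le_one hn']; linarith
    have e2 : 1 - (1 - s) / n ≤ Real.exp (-((1 - s) / n)) := Real.one_sub_le_exp_neg _
    have e3 := pow_le_pow_left₀ e1 e2 r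
    rw [← Real.exp_nat_mul] at e3
    have e4 : (r : ℝ) * -((1 - s) / n) = -b + b * s := by rw [hb]; ring
    rw [e4, Real.exp_add] at e3
    have e5 := Real.exp_bound' (x := b * s) (by positivity) (mul_le_one₀ hb1 hs0 hs1)
      (n := 4) (by norm_num)
    refine e3.trans ((mul_le_mul_of_nonneg_left e5 (Real.exp_pos _).le).trans (le_of_eq ?_))
    simp only [Finset.sum_range_succ, Finset.sum_range_zero, d, Nat.factorial]
    norm_num
    ring
  have h := integral_integral_mono (g := fun s => (1 - (1 - s) / n) ^ r)
    (h := fun s => ∑ k ∈ Finset.range 5, d k * s ^ k) (by fun_prop) (by fun_prop) key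
  rw [integral_integral_finset_sum (Finset.range 5) d fun k => k] at h
  refine h.trans ?_
  have h2 := mul_le_mul_of_nonneg_left (polynomial_le_exp_rate hb0 hb1) (Real.exp_pos (-b)).le
  rw [← Real.exp_add] at h2
  have e6 : -b + (b - rate * b) = -rate * b := by ring
  rw [e6] at h2
  refine le_trans (le_of_eq ?_) h2
  simp only [Finset.sum_range_succ, Finset.sum_range_zero, d, Nat.factorial]
  norm_num
  ring

/-! ### The cubic potential -/

theorem sum_cube_sub_self_le {ι : Type*} (s : Finset ι) (a : ι → ℕ) (n : ℕ) (hs : s.Nonempty)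
    (hsum : ∑ j ∈ s, a j = n) (hbal : ∀ j ∈ s, a j = n / s.card ∨ a j = n / s.card + 1) :
    ∑ j ∈ s, ((a j : ℝ) ^ 3 - a j) ≤ (((n + 1 : ℕ) : ℝ) ^ 3 - (n + 1 : ℕ)) / (s.card : ℝ) ^ 2 := by
  have hK : (0 : ℝ) < s.card := by exact_mod_cast hs.card_pos
  set q : ℕ := n / s.card with hq
  -- On the two admissible values q and q + 1 the cubic coincides with its chord, so the sum depends
  -- only on n, q and the number of parts.
  have h1 : ∀ j ∈ s, (a j : ℝ) ^ 3 - a j =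
      (3 * (q : ℝ) ^ 2 + 3 * q) * a j - q * (q + 1) * (2 * q + 1) := by
    intro j hj
    rcases hbal j hj with h | h <;> rw [h] <;> push_cast <;> ring
  rw [Finset.sum_congr rfl h1, Finset.sum_sub_distrib, ← Finset.mul_sum, ← Nat.cast_sum, hsum,
    Finset.sum_const, nsmul_eq_mul, le_div_iff₀ (by positivity)]
  obtain ⟨d, hd⟩ : ∃ d : ℕ, n = s.card * q + d := ⟨n % s.card, (Nat.div_add_mod n s.card).symm⟩
  have hd' : (n : ℝ) = s.card * q + d := by exact_mod_cast hd
  push_cast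
  rw [hd']
  clear_value q
  generalize (s.card : ℝ) = K at hK ⊢
  have hX : 0 ≤ K * q := by positivity
  have hd0 : (0 : ℝ) ≤ d := by positivity
  -- With X = Kq and n = X + d, the slack is X·(3d² − 3dK + K²) + d³ + 3n² + 2n; the quadratic form
  -- in d and K has negative discriminant.
  have h2 : 0 ≤ 3 * (d : ℝ) ^ 2 - 3 * d * K + K ^ 2 := by
    nlinarith [sq_nonneg ((d : ℝ) - K / 2), sq_nonneg K]
  have h3 := mul_nonneg hX h2
  have h4 : 0 ≤ (d : ℝ) ^ 3 := by positivity
  have h5 : 0 ≤ K * q + d := by positivity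
  have h6 : (0 : ℝ) ≤ 3 * (K * q + d) ^ 2 + 2 * (K * q + d) := by positivity
  nlinarith

/-- A measure of the imbalance of the queues that vanishes when no queue holds two tasks. -/
def potential {m : ℕ} (v : Fin m → ℕ) : ℝ := ∑ i, ((v i : ℝ) ^ 3 - v i)

theorem cube_sub_self_nonneg (a : ℕ) : (0 : ℝ) ≤ (a : ℝ) ^ 3 - a := by
  rcases Nat.eq_zero_or_pos a with rfl | h
  · norm_num
  · have : (1 : ℝ) ≤ a := by exact_mod_cast h
    nlinarith [sq_nonneg ((a : ℝ) - 1)]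

theorem potential_nonneg {m : ℕ} (v : Fin m → ℕ) : 0 ≤ potential v :=
  Finset.sum_nonneg fun _ _ => cube_sub_self_nonneg _

theorem six_le_potential {m : ℕ} {v : Fin m → ℕ} {i : Fin m} (h : 2 ≤ v i) : 6 ≤ potential v := by
  have h' : (2 : ℝ) ≤ v i := by exact_mod_cast h
  refine le_trans ?_ (Finset.single_le_sum (f := fun i => (v i : ℝ) ^ 3 - v i)
    (fun _ _ => cube_sub_self_nonneg _) (Finset.mem_univ i))
  nlinarith [mul_nonneg (sub_nonneg.2 h') (sub_nonneg.2 h'), mul_nonneg (sub_nonneg.2 h')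
    (mul_nonneg (sub_nonneg.2 h') (sub_nonneg.2 h'))]

theorem potential_le_pow {m : ℕ} (v : Fin m → ℕ) : potential v ≤ ((∑ i, v i : ℕ) : ℝ) ^ 3 := by
  have h : ∀ i, v i ≤ ∑ i, v i := fun i =>
    Finset.single_le_sum (fun _ _ => Nat.zero_le _) (Finset.mem_univ i)
  have h1 : ∑ i, v i ^ 3 ≤ (∑ i, v i) ^ 3 := by
    calc ∑ i, v i ^ 3 ≤ ∑ i, v i * (∑ i, v i) ^ 2 :=
          Finset.sum_le_sum fun i _ => by
            rw [pow_succ' (v i) 2]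
            exact Nat.mul_le_mul_left _ (Nat.pow_le_pow_left (h i) 2)
      _ = (∑ i, v i) ^ 3 := by rw [← Finset.sum_mul]; ring
  calc potential v ≤ ∑ i, (v i : ℝ) ^ 3 :=
        Finset.sum_le_sum fun i _ => sub_le_self _ (Nat.cast_nonneg _)
    _ ≤ _ := by exact_mod_cast h1

/-! ### Effect of one slot on tasks and potential -/

section Step

variable {m : ℕ} {v v' : Fin m → ℕ} {f : Fin m → Fin m}

theorem mem_idle {i : Fin m} : i ∈ idle v ↔ v i = 0 := by simp [idle]

/-- Active victims with their thieves form disjoint groups, and every processor outside them has an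
empty queue after the slot. -/
theorem CoopStep.sum_eq (h : CoopStep v f v') (g : ℕ → ℝ) (hg : g 0 = 0) :
    ∑ j, g (v' j) = ∑ i ∈ (idle v)ᶜ, ∑ j ∈ insert i (thieves v f i), g (v' j) := by
  have h1 : ∀ i ∈ (idle v)ᶜ, ∑ j ∈ insert i (thieves v f i), g (v' j) =
      g (v' i) + ∑ j ∈ thieves v f i, g (v' j) := by
    intro i hi
    rw [Finset.sum_insert]
    intro h2
    exact (Finset.mem_compl.1 hi) (Finset.mem_filter.1 h2).1
  have h2 : ∑ j ∈ idle v, g (v' j) = ∑ i, ∑ j ∈ thieves v f i, g (v' j) :=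
    (Finset.sum_fiberwise (idle v) f fun j => g (v' j)).symm
  have h3 : ∑ i ∈ idle v, ∑ j ∈ thieves v f i, g (v' j) = 0 := by
    refine Finset.sum_eq_zero fun i hi => Finset.sum_eq_zero fun j hj => ?_
    obtain ⟨hj1, rfl⟩ := Finset.mem_filter.1 hj
    rw [h.failed j (mem_idle.1 hj1) (mem_idle.1 hi), hg]
  rw [Finset.sum_congr rfl h1, Finset.sum_add_distrib, ← Finset.sum_add_sum_compl (idle v), h2,
    ← Finset.sum_add_sum_compl (idle v) fun i => ∑ j ∈ thieves v f i, g (v' j), h3]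
  ring

theorem CoopStep.sum_insert (h : CoopStep v f v') {i : Fin m} (hi : 0 < v i) :
    ∑ j ∈ insert i (thieves v f i), v' j + 1 = v i := by
  rw [Finset.sum_insert, h.total i hi]
  intro h2
  exact hi.ne' (mem_idle.1 (Finset.mem_filter.1 h2).1)

theorem CoopStep.sum_tasks (h : CoopStep v f v') :
    ((∑ i, v' i : ℕ) : ℝ) = (∑ i, v i : ℕ) - m + (idle v).card := by
  push_cast
  rw [h.sum_eq (fun a => (a : ℝ)) (by simp), ← Finset.sum_add_sum_compl (idle v) fun i => (v i : ℝ)]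
  have h1 : ∑ i ∈ idle v, (v i : ℝ) = 0 :=
    Finset.sum_eq_zero fun i hi => by rw [mem_idle.1 hi]; simp
  have h2 : ∀ i ∈ (idle v)ᶜ, ∑ j ∈ insert i (thieves v f i), (v' j : ℝ) = (v i : ℝ) - 1 := by
    intro i hi
    have := h.sum_insert (Nat.pos_of_ne_zero fun h0 => Finset.mem_compl.1 hi (mem_idle.2 h0))
    rw [← this]; push_cast; ring
  have h3 : ((idle v).card : ℝ) + ((idle v)ᶜ.card : ℝ) = m := by
    exact_mod_cast (Finset.card_add_card_compl (idle v)).trans (Fintype.card_fin m)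
  rw [Finset.sum_congr rfl h2, h1, Finset.sum_sub_distrib, Finset.sum_const, nsmul_eq_mul]
  linarith

theorem CoopStep.potential_le (h : CoopStep v f v') :
    potential v' ≤
      ∑ i ∈ (idle v)ᶜ, ((v i : ℝ) ^ 3 - v i) * (1 / (((thieves v f i).card : ℝ) + 1) ^ 2) := by
  rw [potential, h.sum_eq (fun a => (a : ℝ) ^ 3 - a) (by simp)]
  refine Finset.sum_le_sum fun i hi => ?_
  have hi0 : 0 < v i := Nat.pos_of_ne_zero fun h0 => Finset.mem_compl.1 hi (mem_idle.2 h0)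
  have hc : (insert i (thieves v f i)).card = (thieves v f i).card + 1 := by
    rw [Finset.card_insert_of_notMem]
    intro h2
    exact hi0.ne' (mem_idle.1 (Finset.mem_filter.1 h2).1)
  have hs := h.sum_insert hi0
  have := sum_cube_sub_self_le (insert i (thieves v f i)) v' (v i - 1)
    (Finset.insert_nonempty _ _) (by omega) (by rw [hc]; exact h.balanced i hi0)
  rw [hc, Nat.sub_add_cancel hi0] at this
  push_cast at this
  rw [mul_one_div]
  exact this

theorem CoopStep.eq_zero (h : CoopStep v f v') (hv : ∀ i, v i ≤ 1) (j : Fin m) : v' j = 0 := by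
  have h2 : ∀ i, 0 < v i → ∀ j ∈ insert i (thieves v f i), v' j = 0 := by
    intro i hi
    have h1 := h.sum_insert hi
    have h3 := hv i
    exact Finset.sum_eq_zero_iff.1 (by omega)
  by_cases hj : v j = 0
  · by_cases hf : v (f j) = 0
    · exact h.failed j hj hf
    · exact h2 _ (Nat.pos_of_ne_zero hf) j (Finset.mem_insert_of_mem
        (Finset.mem_filter.2 ⟨mem_idle.2 hj, rfl⟩))
  · exact h2 j (Nat.pos_of_ne_zero hj) j (Finset.mem_insert_self _ _)

end Step

/-! ### Averaging over the random requests -/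

/-- The possible targets of the requests when the processors in `S` are idle; the entries of the
other processors are immaterial. -/
def requests {m : ℕ} (S : Finset (Fin m)) : Finset (Fin m → Fin m) :=
  Fintype.piFinset fun j => if j ∈ S then Finset.univ.erase j else {j}

theorem card_requests {m : ℕ} (S : Finset (Fin m)) : (requests S).card = (m - 1) ^ S.card := by
  rw [requests, Fintype.card_piFinset]
  have : ∀ j, (if j ∈ S then Finset.univ.erase j else {j} : Finset (Fin m)).card =
      if j ∈ S then m - 1 else 1 := by
    intro j; split_ifs <;> simp
  simp only [this]
  rw [Finset.prod_ite_mem, Finset.univ_inter, Finset.prod_const]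

/-- The sum factors over idle processors: each has one choice hitting i, of weight s, and m − 2
others of weight 1. -/
theorem sum_requests_pow {m : ℕ} (S : Finset (Fin m)) (i : Fin m) (hi : i ∉ S) (s : ℝ) :
    ∑ f ∈ requests S, s ^ (S.filter fun j => f j = i).card = ((m : ℝ) - 2 + s) ^ S.card := by
  have h1 : ∀ f : Fin m → Fin m, s ^ (S.filter fun j => f j = i).card =
      ∏ j, if j ∈ S then (if f j = i then s else 1) else 1 := by
    intro f
    rw [Finset.prod_ite_mem, Finset.univ_inter, ← Finset.prod_filter, Finset.prod_const]
  simp only [h1]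
  rw [requests, ← Finset.prod_univ_sum
    (fun j => if j ∈ S then Finset.univ.erase j else {j})
    fun (j k : Fin m) => if j ∈ S then (if k = i then s else 1) else (1 : ℝ)]
  have h2 : ∀ j, (∑ k ∈ (if j ∈ S then Finset.univ.erase j else {j} : Finset (Fin m)),
      if j ∈ S then (if k = i then s else 1) else (1 : ℝ)) =
      if j ∈ S then ((m : ℝ) - 2 + s) else 1 := by
    intro j
    by_cases hj : j ∈ S
    · have hij : i ∈ Finset.univ.erase j := by
        refine Finset.mem_erase.2 ⟨?_, Finset.mem_univ _⟩
        rintro rfl; exact hi hj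
      have hm : 1 ≤ ((Finset.univ : Finset (Fin m)).erase j).card := Finset.card_pos.2 ⟨i, hij⟩
      have hc : ((Finset.univ : Finset (Fin m)).erase j).card + 1 = m := by
        rw [Finset.card_erase_add_one (Finset.mem_univ j), Finset.card_univ, Fintype.card_fin]
      simp only [hj, if_true]
      rw [← Finset.add_sum_erase _ _ hij, if_pos rfl,
        Finset.sum_congr rfl (g := fun _ => (1 : ℝ)) fun k hk => if_neg (Finset.ne_of_mem_erase hk),
        Finset.sum_const, nsmul_eq_mul, Finset.card_erase_of_mem hij, Nat.cast_sub hm]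
      have : (m : ℝ) = (Finset.univ.erase j).card + 1 := by exact_mod_cast hc.symm
      rw [this]; push_cast; ring
    · simp [hj]
  rw [Finset.prod_congr rfl fun j _ => h2 j, Finset.prod_ite_mem, Finset.univ_inter,
    Finset.prod_const]

theorem sum_requests_inv_sq_le {m : ℕ} (S : Finset (Fin m)) (i : Fin m) (hi : i ∉ S) :
    ∑ f ∈ requests S, (1 / ((m : ℝ) - 1)) ^ S.card *
        (1 / (((S.filter fun j => f j = i).card : ℝ) + 1) ^ 2) ≤
      Real.exp (-rate * (S.card / m)) := by
  rw [← integral_integral_finset_sum (requests S) (fun _ => (1 / ((m : ℝ) - 1)) ^ S.card)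
    fun f => (S.filter fun j => f j = i).card]
  have hcard : S.card + 1 ≤ m := by
    have := Finset.card_le_univ (insert i S)
    rwa [Finset.card_insert_of_notMem hi, Fintype.card_fin] at this
  -- This case covers m = 1, where 1/(m − 1) is 0 in Lean but only its zeroth power occurs.
  rcases Nat.eq_zero_or_pos S.card with h0 | h0
  · have := sum_requests_pow S i hi
    simp only [← Finset.mul_sum, this]
    simp [h0]
  obtain ⟨n, rfl⟩ : ∃ n, m = n + 1 := ⟨m - 1, by omega⟩
  have hn : 0 < n := by omega
  have hn' : (0 : ℝ) < n := by exact_mod_cast hn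
  have hS : S.card ≤ n := by omega
  have h := integral_integral_one_sub_pow_le hS hn
  have e : ∀ s : ℝ, ∑ f ∈ requests S, (1 / (((n + 1 : ℕ) : ℝ) - 1)) ^ S.card *
      s ^ (S.filter fun j => f j = i).card = (1 - (1 - s) / n) ^ S.card := by
    intro s
    rw [← Finset.mul_sum, sum_requests_pow S i hi, ← mul_pow]
    congr 1
    push_cast
    rw [add_sub_cancel_right]
    field_simp
    ring
  simp only [e]
  refine h.trans (Real.exp_le_exp.2 ?_)
  -- Weakening m − 1 to m makes the exponent match the fraction of processors that execute no task.
  have : (S.card : ℝ) / ((n + 1 : ℕ) : ℝ) ≤ S.card / n := by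
    gcongr; linarith
  nlinarith [rate_pos]

/-! ### One-slot contraction of the discounted potential -/

/-- The potential, discounted for the tasks already executed. -/
noncomputable def discounted {m : ℕ} (v : Fin m → ℕ) : ℝ :=
  potential v * Real.exp (rate * ((∑ i, v i : ℕ) / m))

/-- A bound on the discounted potential after a slot that starts from `v` with targets `f`. -/
noncomputable def stepBound {m : ℕ} (v : Fin m → ℕ) (f : Fin m → Fin m) : ℝ :=
  (∑ i ∈ (idle v)ᶜ, ((v i : ℝ) ^ 3 - v i) * (1 / (((thieves v f i).card : ℝ) + 1) ^ 2)) *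
    Real.exp (rate * (((∑ i, v i : ℕ) - m + (idle v).card) / m))

theorem stepBound_nonneg {m : ℕ} (v : Fin m → ℕ) (f : Fin m → Fin m) : 0 ≤ stepBound v f :=
  mul_nonneg (Finset.sum_nonneg fun _ _ => mul_nonneg (cube_sub_self_nonneg _) (by positivity))
    (Real.exp_pos _).le

theorem CoopStep.discounted_le {m : ℕ} {v v' : Fin m → ℕ} {f : Fin m → Fin m}
    (h : CoopStep v f v') : discounted v' ≤ stepBound v f := by
  rw [discounted, stepBound, h.sum_tasks]
  exact mul_le_mul_of_nonneg_right h.potential_le (Real.exp_pos _).le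

theorem stepBound_congr {m : ℕ} (v : Fin m → ℕ) {f g : Fin m → Fin m}
    (h : ∀ j ∈ idle v, f j = g j) : stepBound v f = stepBound v g := by
  have : ∀ i, thieves v f i = thieves v g i := fun i =>
    Finset.filter_congr fun j hj => by rw [h j hj]
  simp only [stepBound, this]

theorem sum_stepBound_le {m : ℕ} (v : Fin m → ℕ) :
    ∑ f ∈ requests (idle v), (1 / ((m : ℝ) - 1)) ^ (idle v).card * stepBound v f ≤
      Real.exp (-rate) * discounted v := by
  rcases Nat.eq_zero_or_pos m with rfl | hm
  · simp [stepBound, discounted, potential, Finset.eq_empty_of_isEmpty (idle v)ᶜ]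
  have hm' : (m : ℝ) ≠ 0 := by exact_mod_cast hm.ne'
  set E := Real.exp (rate * (((∑ i, v i : ℕ) - m + (idle v).card) / m))
  have h1 : ∑ f ∈ requests (idle v), (1 / ((m : ℝ) - 1)) ^ (idle v).card * stepBound v f =
      (∑ i ∈ (idle v)ᶜ, ((v i : ℝ) ^ 3 - v i) * ∑ f ∈ requests (idle v),
        (1 / ((m : ℝ) - 1)) ^ (idle v).card *
          (1 / (((thieves v f i).card : ℝ) + 1) ^ 2)) * E := by
    simp only [stepBound, Finset.mul_sum, Finset.sum_mul]
    rw [Finset.sum_comm]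
    refine Finset.sum_congr rfl fun i _ => Finset.sum_congr rfl fun f _ => ?_
    ring
  have h2 : ∑ i ∈ (idle v)ᶜ, ((v i : ℝ) ^ 3 - v i) * ∑ f ∈ requests (idle v),
        (1 / ((m : ℝ) - 1)) ^ (idle v).card * (1 / (((thieves v f i).card : ℝ) + 1) ^ 2) ≤
      potential v * Real.exp (-rate * ((idle v).card / m)) := by
    rw [potential, Finset.sum_mul]
    refine (Finset.sum_le_sum fun i hi => mul_le_mul_of_nonneg_left
      (sum_requests_inv_sq_le (idle v) i (Finset.mem_compl.1 hi))
      (cube_sub_self_nonneg _)).trans ?_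
    exact Finset.sum_le_sum_of_subset_of_nonneg (Finset.subset_univ _) fun i _ _ =>
      mul_nonneg (cube_sub_self_nonneg _) (Real.exp_pos _).le
  rw [h1]
  refine (mul_le_mul_of_nonneg_right h2 (Real.exp_pos _).le).trans (le_of_eq ?_)
  rw [discounted, mul_assoc, ← Real.exp_add, mul_left_comm (Real.exp (-rate)), ← Real.exp_add]
  congr 2
  field_simp
  ring

theorem pairwiseDisjoint_requests {Ω : Type*} {m : ℕ} (A : Set Ω) (g : Ω → Fin m → Fin m) (S : Finset (Fin m)) :
    (requests S : Set (Fin m → Fin m)).PairwiseDisjoint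
      fun f => A ∩ {ω | ∀ j ∈ S, g ω j = f j} := by
  intro f hf f' hf' hne
  refine Set.disjoint_left.2 fun ω h1 h2 => hne (funext fun j => ?_)
  by_cases hj : j ∈ S
  · exact (h1.2 j hj).symm.trans (h2.2 j hj)
  · have e1 := Fintype.mem_piFinset.1 hf j
    have e2 := Fintype.mem_piFinset.1 hf' j
    rw [if_neg hj, Finset.mem_singleton] at e1 e2
    rw [e1, e2]

/-! ### Expected decay along the process -/

section Dynamics

variable {Ω : Type*} [MeasurableSpace Ω] {P : Measure Ω}
  {ℱ : Filtration ℕ (inferInstance : MeasurableSpace Ω)} {m W : ℕ}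
  {w : ℕ → Ω → Fin m → ℕ} {target : ℕ → Ω → Fin m → Fin m}

theorem IsCoopWorkStealing.measurable (hw : IsCoopWorkStealing P ℱ m W w target) (t : ℕ) :
    Measurable (w t) :=
  (hw.adapted t).mono (ℱ.le t) le_rfl

theorem IsCoopWorkStealing.measure_request [IsProbabilityMeasure P]
    (hw : IsCoopWorkStealing P ℱ m W w target) (t : ℕ) (v : Fin m → ℕ) {f : Fin m → Fin m} (hf : f ∈ requests (idle v)) :
    P (w t ⁻¹' {v} ∩ {ω | ∀ j ∈ idle v, target t ω j = f j}) =
      P (w t ⁻¹' {v}) * ENNReal.ofReal ((1 / ((m : ℝ) - 1)) ^ (idle v).card) := by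
  have h := hw.request t (idle v) f (w t ⁻¹' {v})
    (fun j hj => by
      have := Fintype.mem_piFinset.1 hf j
      rw [if_pos hj] at this
      exact Finset.ne_of_mem_erase this)
    (hw.adapted t (measurableSet_singleton v))
    (fun ω hω => by rw [Set.mem_preimage, Set.mem_singleton_iff] at hω; rw [hω])
  rw [← ENNReal.ofReal_toReal (measure_ne_top P (w t ⁻¹' {v})),
    ← ENNReal.ofReal_mul ENNReal.toReal_nonneg,
    ← ENNReal.ofReal_toReal (measure_ne_top P (w t ⁻¹' {v} ∩ _))]
  exact congrArg ENNReal.ofReal h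

theorem measurableSet_request (hw : IsCoopWorkStealing P ℱ m W w target) (t : ℕ)
    (S : Finset (Fin m)) (f : Fin m → Fin m) :
    MeasurableSet {ω | ∀ j ∈ S, target t ω j = f j} := by
  have : {ω | ∀ j ∈ S, target t ω j = f j} = target t ⁻¹' {g | ∀ j ∈ S, g j = f j} := rfl
  rw [this]
  exact hw.measurable_target t (Set.toFinite _).measurableSet

/-- As long as some processor is active, almost surely no idle processor targets itself. -/
theorem IsCoopWorkStealing.ae_mem_requests [IsProbabilityMeasure P]
    (hw : IsCoopWorkStealing P ℱ m W w target) (t : ℕ) {v : Fin m → ℕ} (hv : idle v ≠ Finset.univ) :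
    (⋃ f ∈ requests (idle v), w t ⁻¹' {v} ∩ {ω | ∀ j ∈ idle v, target t ω j = f j} : Set Ω)
      =ᵐ[P] w t ⁻¹' {v} := by
  have hA : MeasurableSet (w t ⁻¹' {v}) := hw.measurable t (measurableSet_singleton v)
  have hB : ∀ f ∈ requests (idle v),
      MeasurableSet (w t ⁻¹' {v} ∩ {ω | ∀ j ∈ idle v, target t ω j = f j}) :=
    fun f _ => hA.inter (measurableSet_request hw t _ f)
  refine ae_eq_of_subset_of_measure_ge (Set.iUnion₂_subset fun f _ => Set.inter_subset_left) ?_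
    (Finset.measurableSet_biUnion _ hB).nullMeasurableSet (measure_ne_top P _)
  -- The (m−1)^#S admissible choices each carry a fraction (m−1)^(−#S) of the event, so together
  -- they exhaust it.
  rw [measure_biUnion_finset (pairwiseDisjoint_requests _ _ _) hB,
    Finset.sum_congr rfl fun f hf => hw.measure_request t v hf, Finset.sum_const, nsmul_eq_mul,
    card_requests]
  refine le_of_eq ?_
  have hlt : (idle v).card < m := by
    have := Finset.card_lt_univ_of_notMem
      (Classical.not_forall.1 fun h => hv (Finset.eq_univ_iff_forall.2 h)).choose_spec
    rwa [Fintype.card_fin] at this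
  have e : (((m - 1) ^ (idle v).card : ℕ) : ENNReal) *
      ENNReal.ofReal ((1 / ((m : ℝ) - 1)) ^ (idle v).card) = 1 := by
    rw [← ENNReal.ofReal_natCast, ← ENNReal.ofReal_mul (Nat.cast_nonneg _), Nat.cast_pow,
      Nat.cast_sub (by omega), ← mul_pow]
    rcases Nat.eq_zero_or_pos (idle v).card with h0 | h0
    · simp [h0]
    · have : (m : ℝ) - 1 ≠ 0 := by
        have : (2 : ℝ) ≤ m := by exact_mod_cast (show 2 ≤ m by omega)
        linarith
      rw [Nat.cast_one, mul_one_div_cancel this]; simp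
  rw [mul_left_comm, e, mul_one]

/-- Restricting to the fibre of a single state v replaces conditional expectation; the state space
is countable, so summing over v recovers the full integral. -/
theorem IsCoopWorkStealing.setLIntegral_discounted_le [IsProbabilityMeasure P]
    (hw : IsCoopWorkStealing P ℱ m W w target) (t : ℕ) (v : Fin m → ℕ) :
    ∫⁻ ω in w t ⁻¹' {v}, ENNReal.ofReal (discounted (w (t + 1) ω)) ∂P ≤
      ENNReal.ofReal (Real.exp (-rate)) * (ENNReal.ofReal (discounted v) * P (w t ⁻¹' {v})) := by
  have hA : MeasurableSet (w t ⁻¹' {v}) := hw.measurable t (measurableSet_singleton v)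
  -- With nobody active, `requests` may be empty (m = 1), but the next state is empty and its
  -- discounted potential vanishes.
  by_cases hv : idle v = Finset.univ
  · have h0 : ∫⁻ ω in w t ⁻¹' {v}, ENNReal.ofReal (discounted (w (t + 1) ω)) ∂P = 0 := by
      rw [lintegral_eq_zero_iff' ?_]
      · rw [Filter.EventuallyEq, ae_restrict_iff' hA]
        filter_upwards [hw.step t] with ω hω hωv
        rw [Set.mem_preimage, Set.mem_singleton_iff] at hωv
        have hz : ∀ j, w (t + 1) ω j = 0 := hω.eq_zero fun i => by
          have : v i = 0 := mem_idle.1 (hv ▸ Finset.mem_univ i)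
          rw [hωv, this]; exact zero_le_one
        simp [discounted, potential, hz]
      · exact ((measurable_of_countable fun u : Fin m → ℕ =>
          ENNReal.ofReal (discounted u)).comp (hw.measurable (t + 1))).aemeasurable
    rw [h0]; exact zero_le
  have hB : ∀ f ∈ requests (idle v),
      MeasurableSet (w t ⁻¹' {v} ∩ {ω | ∀ j ∈ idle v, target t ω j = f j}) :=
    fun f _ => hA.inter (measurableSet_request hw t _ f)
  rw [← setLIntegral_congr (hw.ae_mem_requests t hv),
    lintegral_biUnion_finset (pairwiseDisjoint_requests _ _ _) hB]
  calc ∑ f ∈ requests (idle v),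
        ∫⁻ ω in w t ⁻¹' {v} ∩ {ω | ∀ j ∈ idle v, target t ω j = f j},
          ENNReal.ofReal (discounted (w (t + 1) ω)) ∂P
      ≤ ∑ f ∈ requests (idle v),
        ∫⁻ ω in w t ⁻¹' {v} ∩ {ω | ∀ j ∈ idle v, target t ω j = f j},
          ENNReal.ofReal (stepBound v f) ∂P := by
        refine Finset.sum_le_sum fun f hf => lintegral_mono_ae ?_
        rw [ae_restrict_iff' (hB f hf)]
        filter_upwards [hw.step t] with ω hω hωv
        have h1 : w t ω = v := hωv.1
        rw [h1] at hω
        rw [← stepBound_congr v hωv.2]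
        exact ENNReal.ofReal_le_ofReal hω.discounted_le
    _ = ∑ f ∈ requests (idle v),
        ENNReal.ofReal ((1 / ((m : ℝ) - 1)) ^ (idle v).card * stepBound v f) *
          P (w t ⁻¹' {v}) := by
        refine Finset.sum_congr rfl fun f hf => ?_
        rw [setLIntegral_const, hw.measure_request t v hf,
          ENNReal.ofReal_mul' (stepBound_nonneg v f)]
        ring
    _ = ENNReal.ofReal (∑ f ∈ requests (idle v),
          (1 / ((m : ℝ) - 1)) ^ (idle v).card * stepBound v f) * P (w t ⁻¹' {v}) := by
        have hlt : 1 ≤ m := by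
          rcases Nat.eq_zero_or_pos m with rfl | h
          · exact absurd (Subsingleton.elim _ _) hv
          · exact h
        have : (0 : ℝ) ≤ 1 / ((m : ℝ) - 1) :=
          one_div_nonneg.2 (sub_nonneg.2 (by exact_mod_cast hlt))
        rw [ENNReal.ofReal_sum_of_nonneg fun f _ =>
          mul_nonneg (pow_nonneg this _) (stepBound_nonneg v f), Finset.sum_mul]
    _ ≤ _ := by
        rw [← mul_assoc, ← ENNReal.ofReal_mul (Real.exp_pos _).le]
        gcongr
        exact sum_stepBound_le v

theorem lintegral_eq_tsum_fiber {ι : Type*} [Countable ι] [MeasurableSpace ι]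
    [MeasurableSingletonClass ι] (μ : Measure Ω) {X : Ω → ι} (hX : Measurable X)
    (g : Ω → ENNReal) :
    ∫⁻ ω, g ω ∂μ = ∑' x, ∫⁻ ω in X ⁻¹' {x}, g ω ∂μ := by
  rw [← lintegral_iUnion (fun x => hX (measurableSet_singleton x))
    (fun x y hxy => (Set.disjoint_singleton.2 hxy).preimage X), ← Set.preimage_iUnion,
    Set.iUnion_of_singleton, Set.preimage_univ, Measure.restrict_univ]

theorem IsCoopWorkStealing.lintegral_discounted_succ_le [IsProbabilityMeasure P]
    (hw : IsCoopWorkStealing P ℱ m W w target) (t : ℕ) :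
    ∫⁻ ω, ENNReal.ofReal (discounted (w (t + 1) ω)) ∂P ≤
      ENNReal.ofReal (Real.exp (-rate)) * ∫⁻ ω, ENNReal.ofReal (discounted (w t ω)) ∂P := by
  rw [lintegral_eq_tsum_fiber P (hw.measurable t),
    lintegral_eq_tsum_fiber P (hw.measurable t) fun ω => ENNReal.ofReal (discounted (w t ω)),
    ← ENNReal.tsum_mul_left]
  refine ENNReal.tsum_le_tsum fun v => (hw.setLIntegral_discounted_le t v).trans (le_of_eq ?_)
  congr 1
  rw [← setLIntegral_const]
  refine setLIntegral_congr_fun (hw.measurable t (measurableSet_singleton v)) fun ω hω => ?_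
  rw [Set.mem_preimage, Set.mem_singleton_iff] at hω
  simp only [hω]

theorem IsCoopWorkStealing.lintegral_discounted_le [IsProbabilityMeasure P]
    (hw : IsCoopWorkStealing P ℱ m W w target) (t : ℕ) :
    ∫⁻ ω, ENNReal.ofReal (discounted (w t ω)) ∂P ≤
      ENNReal.ofReal ((W : ℝ) ^ 3 * Real.exp (rate * (W / m - t))) := by
  induction t with
  | zero =>
    calc ∫⁻ ω, ENNReal.ofReal (discounted (w 0 ω)) ∂P
        ≤ ∫⁻ ω, ENNReal.ofReal ((W : ℝ) ^ 3 * Real.exp (rate * (W / m))) ∂P := by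
          refine lintegral_mono_ae ?_
          filter_upwards [hw.init] with ω hω
          refine ENNReal.ofReal_le_ofReal ?_
          rw [discounted, hω]
          have := potential_le_pow (w 0 ω)
          rw [hω] at this
          exact mul_le_mul_of_nonneg_right this (Real.exp_pos _).le
      _ = _ := by simp
  | succ t ih =>
    refine (hw.lintegral_discounted_succ_le t).trans ?_
    refine (mul_le_mul_right ih _).trans (le_of_eq ?_)
    rw [← ENNReal.ofReal_mul (Real.exp_pos _).le, mul_left_comm, ← Real.exp_add]
    congr 3
    push_cast; ring

theorem IsCoopWorkStealing.measure_exists_two_le [IsProbabilityMeasure P]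
    (hw : IsCoopWorkStealing P ℱ m W w target) (t : ℕ) :
    P {ω | ∃ i, 2 ≤ w t ω i} ≤
      ENNReal.ofReal ((W : ℝ) ^ 3 * Real.exp (rate * (W / m - t)) / 6) := by
  have hmeas : Measurable fun ω => ENNReal.ofReal (discounted (w t ω)) :=
    (measurable_of_countable fun u : Fin m → ℕ => ENNReal.ofReal (discounted u)).comp
      (hw.measurable t)
  have h1 : {ω | ∃ i, 2 ≤ w t ω i} ⊆ {ω | 6 ≤ ENNReal.ofReal (discounted (w t ω))} := by
    rintro ω ⟨i, hi⟩
    have h6 : (6 : ℝ) ≤ discounted (w t ω) := by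
      refine (six_le_potential hi).trans
        (le_mul_of_one_le_right (potential_nonneg _) (Real.one_le_exp ?_))
      have := rate_pos
      positivity
    simpa using ENNReal.ofReal_le_ofReal h6
  refine (measure_mono h1).trans ((meas_ge_le_lintegral_div hmeas.aemeasurable (by norm_num)
    (by norm_num)).trans ?_)
  rw [ENNReal.ofReal_div_of_pos (by norm_num)]
  refine ENNReal.div_le_div (hw.lintegral_discounted_le t) ?_
  simp

end Dynamics

theorem makespan_le {Ω : Type*} {m : ℕ} {w : ℕ → Ω → Fin m → ℕ} {ω : Ω} {t : ℕ}
    (hz : ∀ i, w t ω i = 0) : makespan w ω ≤ t :=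
  Nat.sInf_le hz

/-! ### From the decay to the makespan -/

section Makespan

variable {Ω : Type*} [MeasurableSpace Ω] {P : Measure Ω}
  {ℱ : Filtration ℕ (inferInstance : MeasurableSpace Ω)} {m W : ℕ}
  {w : ℕ → Ω → Fin m → ℕ} {target : ℕ → Ω → Fin m → Fin m}

/-- The leading part of the bounds on the makespan. -/
noncomputable def mainTerm (m W : ℕ) : ℝ := (W : ℝ) / m + 2.88 * Real.logb 2 W

theorem mainTerm_nonneg (m W : ℕ) : 0 ≤ mainTerm m W := by
  have : 0 ≤ Real.logb 2 W := by
    rcases Nat.eq_zero_or_pos W with rfl | h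
    · simp
    · exact Real.logb_nonneg one_lt_two (by exact_mod_cast h)
  unfold mainTerm
  positivity

theorem log_two_le_rate : Real.log 2 ≤ rate := by
  have := Real.log_pos one_lt_two
  unfold rate; linarith

theorem pow_three_mul_exp_rate (m : ℕ) {W : ℕ} (hW : 0 < W) (t : ℝ) :
    (W : ℝ) ^ 3 * Real.exp (rate * (W / m - t)) = Real.exp (-(rate * (t - mainTerm m W))) := by
  have hW' : (0 : ℝ) < W := by exact_mod_cast hW
  have h2 : Real.log 2 ≠ 0 := (Real.log_pos one_lt_two).ne'
  -- Here 2.88 · 25/24 = 3, the degree of the potential.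
  have h3 : rate * (2.88 * Real.logb 2 W) = 3 * Real.log W := by
    rw [rate, Real.logb]
    field_simp
    ring
  have h4 : (W : ℝ) ^ 3 = Real.exp (3 * Real.log W) := by
    rw [mul_comm, Real.exp_mul, Real.exp_log hW']
    norm_cast
  rw [h4, ← h3, ← Real.exp_add, mainTerm]
  congr 1
  ring

theorem IsCoopWorkStealing.measurable_makespan (hw : IsCoopWorkStealing P ℱ m W w target) :
    Measurable (makespan w) := by
  have h0 : ∀ t, MeasurableSet {ω | ∀ i, w t ω i = 0} := fun t =>
    hw.measurable t (Set.to_countable {u : Fin m → ℕ | ∀ i, u i = 0}).measurableSet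
  refine measurable_of_Iic fun n => ?_
  have : makespan w ⁻¹' Set.Iic n = (⋃ t ∈ Set.Iic n, {ω | ∀ i, w t ω i = 0}) ∪
      ⋂ t, {ω | ∀ i, w t ω i = 0}ᶜ := by
    ext ω
    simp only [Set.mem_preimage, Set.mem_Iic, Set.mem_union, Set.mem_iUnion, Set.mem_iInter,
      Set.mem_compl_iff, Set.mem_ofPred_eq, exists_prop]
    constructor
    · intro h
      by_cases hne : {t | ∀ i, w t ω i = 0}.Nonempty
      · exact Or.inl ⟨_, h, Nat.sInf_mem hne⟩
      · exact Or.inr fun t ht => hne ⟨t, ht⟩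
    · rintro (⟨t, ht, hz⟩ | h)
      · exact (makespan_le hz).trans ht
      -- A path that never empties has makespan `sInf ∅ = 0`.
      · have : {t | ∀ i, w t ω i = 0} = ∅ := Set.eq_empty_iff_forall_notMem.2 h
        rw [makespan, this, Nat.sInf_empty]
        exact Nat.zero_le n
  rw [this]
  exact (MeasurableSet.biUnion (Set.to_countable _) fun t _ => h0 t).union
    (MeasurableSet.iInter fun t => (h0 t).compl)

/-- If all queues hold at most one task at time t, they are empty at t + 1; a makespan of t + 2 or
more thus needs a queue with two tasks at time t. -/
theorem IsCoopWorkStealing.measure_add_two_le_makespan [IsProbabilityMeasure P]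
    (hw : IsCoopWorkStealing P ℱ m W w target) (hW : 0 < W) (t : ℕ) :
    P {ω | t + 2 ≤ makespan w ω} ≤
      ENNReal.ofReal (Real.exp (-(rate * (t - mainTerm m W))) / 6) := by
  rw [← pow_three_mul_exp_rate m hW]
  refine le_trans (measure_mono_ae ?_) (hw.measure_exists_two_le t)
  filter_upwards [hw.step t] with ω hω (h : t + 2 ≤ makespan w ω)
  by_contra hn
  have hz : ∀ i, w (t + 1) ω i = 0 := hω.eq_zero fun i => by
    by_contra hi
    exact hn ⟨i, by omega⟩
  have : makespan w ω ≤ t + 1 := makespan_le hz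
  omega

/-- The makespan tail cannot show this, as `makespan` is 0 on paths that never empty. Such paths
have a queue with two tasks at almost surely every time, which has probability tending to 0. -/
theorem IsCoopWorkStealing.ae_exists_empty [IsProbabilityMeasure P]
    (hw : IsCoopWorkStealing P ℱ m W w target) : ∀ᵐ ω ∂P, ∃ t, ∀ i, w t ω i = 0 := by
  rw [ae_iff]
  have hle : ∀ t : ℕ, P {ω | ¬ ∃ t, ∀ i, w t ω i = 0} ≤
      ENNReal.ofReal ((W : ℝ) ^ 3 * Real.exp (rate * (W / m - t)) / 6) := by
    intro t
    refine le_trans (measure_mono_ae ?_) (hw.measure_exists_two_le t)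
    filter_upwards [hw.step t] with ω hω (h : ¬ ∃ t, ∀ i, w t ω i = 0)
    by_contra hn
    exact h ⟨t + 1, hω.eq_zero fun i => by
      by_contra hi
      exact hn ⟨i, by omega⟩⟩
  have hlim : Filter.Tendsto (fun t : ℕ => ENNReal.ofReal
      ((W : ℝ) ^ 3 * Real.exp (rate * (W / m - t)) / 6)) Filter.atTop (nhds 0) := by
    rw [← ENNReal.ofReal_zero]
    refine ENNReal.tendsto_ofReal ?_
    have h1 : Filter.Tendsto (fun t : ℕ => rate * ((W : ℝ) / m - t)) Filter.atTop Filter.atBot := by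
      refine Filter.Tendsto.const_mul_atBot rate_pos ?_
      exact Filter.tendsto_atBot_add_const_left _ _
        (Filter.tendsto_neg_atTop_atBot.comp tendsto_natCast_atTop_atTop)
    have h2 := ((Real.tendsto_exp_atBot.comp h1).const_mul ((W : ℝ) ^ 3)).div_const 6
    simpa using h2
  exact le_antisymm (ge_of_tendsto' hlim hle) zero_le

theorem natCast_le_add_tsum_indicator (n N : ℕ) :
    (n : ENNReal) ≤ N + ∑' k : ℕ, if N + k + 1 ≤ n then 1 else 0 := by
  have h1 : ((n - N : ℕ) : ENNReal) ≤ ∑' k : ℕ, if N + k + 1 ≤ n then 1 else 0 := by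
    refine le_trans (le_of_eq ?_) (ENNReal.sum_le_tsum (Finset.range (n - N)))
    rw [Finset.sum_congr rfl (g := fun _ => (1 : ENNReal)) fun k hk => if_pos ?_]
    · simp
    · have := Finset.mem_range.1 hk
      omega
  calc (n : ENNReal) ≤ ((N + (n - N) : ℕ) : ENNReal) := by exact_mod_cast (by omega)
    _ ≤ _ := by push_cast; gcongr; simpa using h1

theorem IsCoopWorkStealing.lintegral_makespan_le [IsProbabilityMeasure P]
    (hw : IsCoopWorkStealing P ℱ m W w target) (hW : 0 < W) :
    ∫⁻ ω, (makespan w ω : ENNReal) ∂P ≤ ENNReal.ofReal (mainTerm m W + 3.4) := by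
  set N := ⌈mainTerm m W⌉₊
  have hset : ∀ k, MeasurableSet {ω | N + 2 + k + 1 ≤ makespan w ω} := fun k =>
    hw.measurable_makespan measurableSet_Ici
  -- The first tail term is (1/6)·(1/2), from Markov at level 6 and one halving; the series sums to
  -- 1/6, and rounding up costs at most 1, so the total excess 3 + 1/6 is below 3.4.
  have hk : ∀ k : ℕ, P {ω | N + 2 + k + 1 ≤ makespan w ω} ≤
      ENNReal.ofReal (1 / 12 * (1 / 2) ^ k) := by
    intro k
    have h := hw.measure_add_two_le_makespan hW (N + k + 1)
    rw [show N + k + 1 + 2 = N + 2 + k + 1 by ring] at h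
    refine h.trans (ENNReal.ofReal_le_ofReal ?_)
    have hN : mainTerm m W ≤ N := Nat.le_ceil _
    have h1 : ((k + 1 : ℕ) : ℝ) * Real.log 2 ≤ rate * (((N + k + 1 : ℕ) : ℝ) - mainTerm m W) := by
      rw [mul_comm]
      refine mul_le_mul log_two_le_rate ?_ (Nat.cast_nonneg _) rate_pos.le
      push_cast; linarith
    have h2 : Real.exp (-(((k + 1 : ℕ) : ℝ) * Real.log 2)) = (1 / 2) ^ (k + 1) := by
      rw [Real.exp_neg, Real.exp_nat_mul, Real.exp_log two_pos, one_div, inv_pow]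
    have h3 := Real.exp_le_exp.2 (neg_le_neg h1)
    rw [h2, pow_succ] at h3
    linarith
  calc ∫⁻ ω, (makespan w ω : ENNReal) ∂P
      ≤ ∫⁻ ω, ((N + 2 : ℕ) : ENNReal) +
          ∑' k : ℕ, {ω | N + 2 + k + 1 ≤ makespan w ω}.indicator 1 ω ∂P := by
        refine lintegral_mono fun ω => ?_
        simpa only [Set.indicator_apply, Set.mem_ofPred_eq, Pi.one_apply] using
          natCast_le_add_tsum_indicator (makespan w ω) (N + 2)
    _ = ((N + 2 : ℕ) : ENNReal) + ∑' k : ℕ, P {ω | N + 2 + k + 1 ≤ makespan w ω} := by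
        rw [lintegral_add_left measurable_const, lintegral_const, measure_univ, mul_one,
          lintegral_tsum fun k => (measurable_one.indicator (hset k)).aemeasurable]
        simp only [lintegral_indicator_one (hset _)]
    _ ≤ ((N + 2 : ℕ) : ENNReal) + ∑' k : ℕ, ENNReal.ofReal (1 / 12 * (1 / 2) ^ k) := by
        gcongr with k
        exact hk k
    _ = ENNReal.ofReal ((N + 2 : ℕ) + 1 / 6) := by
        have hs := hasSum_geometric_two.mul_left (1 / 12 : ℝ)
        rw [← ENNReal.ofReal_tsum_of_nonneg (fun k => by positivity) hs.summable, hs.tsum_eq,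
          ENNReal.ofReal_add (Nat.cast_nonneg _) (by norm_num), ENNReal.ofReal_natCast]
        norm_num
    _ ≤ _ := by
        refine ENNReal.ofReal_le_ofReal ?_
        have := Nat.ceil_lt_add_one (mainTerm_nonneg m W)
        push_cast
        norm_num
        linarith

theorem IsCoopWorkStealing.measureReal_makespan_ge_le [IsProbabilityMeasure P]
    (hw : IsCoopWorkStealing P ℱ m W w target) (hW : 0 < W) {ε : ℝ} (hε : 0 < ε) :
    P.real {ω | mainTerm m W + 2 + Real.logb 2 (1 / ε) ≤ (makespan w ω : ℝ)} ≤ ε := by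
  -- For ε < 1 the logarithm of 1/ε is nonnegative, which allows `rate` to be replaced by log 2.
  rcases le_or_gt 1 ε with h1 | h1
  · exact measureReal_le_one.trans h1
  set x := mainTerm m W + 2 + Real.logb 2 (1 / ε) with hx
  have hl : 0 ≤ Real.logb 2 (1 / ε) :=
    Real.logb_nonneg one_lt_two ((one_le_div hε).2 h1.le)
  have hx2 : 2 ≤ x := by linarith [mainTerm_nonneg m W]
  obtain ⟨t, ht⟩ : ∃ t, ⌈x⌉₊ = t + 2 := by
    have h2 : 2 ≤ ⌈x⌉₊ := by exact_mod_cast hx2.trans (Nat.le_ceil x)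
    exact ⟨_, (Nat.sub_add_cancel h2).symm⟩
  have hset : {ω | x ≤ (makespan w ω : ℝ)} = {ω | t + 2 ≤ makespan w ω} := by
    ext ω
    rw [Set.mem_ofPred_eq, Set.mem_ofPred_eq, ← ht, Nat.ceil_le]
  have htx : x ≤ (t : ℝ) + 2 := by exact_mod_cast ht ▸ Nat.le_ceil x
  rw [hset]
  refine ENNReal.toReal_le_of_le_ofReal hε.le ((hw.measure_add_two_le_makespan hW t).trans
    (ENNReal.ofReal_le_ofReal ?_))
  have h3 : -(rate * ((t : ℝ) - mainTerm m W)) ≤ Real.log ε := by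
    have h4 : Real.log 2 * Real.logb 2 (1 / ε) = -Real.log ε := by
      rw [mul_comm, Real.logb, div_mul_cancel₀ _ (Real.log_pos one_lt_two).ne', one_div,
        Real.log_inv]
    have h5 : Real.log 2 * Real.logb 2 (1 / ε) ≤ rate * ((t : ℝ) - mainTerm m W) :=
      mul_le_mul log_two_le_rate (by linarith) hl rate_pos.le
    linarith
  have h6 := Real.exp_le_exp.2 h3
  rw [Real.exp_log hε] at h6
  linarith [Real.exp_pos (-(rate * ((t : ℝ) - mainTerm m W)))]

end Makespan

end CoopStealing

theorem mainTheorem4 {Ω : Type*} [MeasurableSpace Ω] (P : Measure Ω) [IsProbabilityMeasure P]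
    (ℱ : Filtration ℕ (inferInstance : MeasurableSpace Ω)) (m W : ℕ) (hW : 0 < W)
    (w : ℕ → Ω → Fin m → ℕ) (target : ℕ → Ω → Fin m → Fin m)
    (hw : CoopStealing.IsCoopWorkStealing P ℱ m W w target) :
    (∀ᵐ ω ∂P, ∃ t, ∀ i, w t ω i = 0) ∧
    Integrable (fun ω => (CoopStealing.makespan w ω : ℝ)) P ∧
    ∫ ω, (CoopStealing.makespan w ω : ℝ) ∂P ≤ (W : ℝ) / m + 2.88 * Real.logb 2 W + 3.4 ∧
    ∀ ε : ℝ, 0 < ε →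
      P.real {ω | (W : ℝ) / m + 2.88 * Real.logb 2 W + 2 + Real.logb 2 (1 / ε)
        ≤ (CoopStealing.makespan w ω : ℝ)} ≤ ε := by
  have hmeas : AEStronglyMeasurable (fun ω => (CoopStealing.makespan w ω : ℝ)) P :=
    (measurable_from_nat.comp hw.measurable_makespan).aestronglyMeasurable
  have hle : ∫⁻ ω, ENNReal.ofReal (CoopStealing.makespan w ω : ℝ) ∂P ≤
      ENNReal.ofReal (CoopStealing.mainTerm m W + 3.4) := by
    simpa only [ENNReal.ofReal_natCast] using hw.lintegral_makespan_le hW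
  have h0 : ∀ ω, (0 : ℝ) ≤ (CoopStealing.makespan w ω : ℝ) := fun _ => Nat.cast_nonneg _
  refine ⟨hw.ae_exists_empty, ⟨hmeas, ?_⟩, ?_, fun ε hε => hw.measureReal_makespan_ge_le hW hε⟩
  · rw [hasFiniteIntegral_iff_ofReal (Filter.Eventually.of_forall h0)]
    exact hle.trans_lt ENNReal.ofReal_lt_top
  · rw [integral_eq_lintegral_of_nonneg_ae (Filter.Eventually.of_forall h0) hmeas]
    refine ENNReal.toReal_le_of_le_ofReal ?_ hle
    have := CoopStealing.mainTerm_nonneg m W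
    unfold CoopStealing.mainTerm at this
    positivity
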